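/- Let $\mathbb S=\langle S;+,\cdot,0,1\rangle$ be the three-element Boolean semiring: $S=\{0,h,1\}$, $0$ is neutral for $+$, $h+h=h$, $h+1=1+h=1$, $1+1=h$, and $\cdot$ is the minimum for the order $0<h<1$. Let $\mathcal A=ISP(\mathbb S)$ be the quasi-variety it generates (all isomorphic copies of subalgebras of powers of $\mathbb S$). Put $r_1=S^2\setminus\{(1,0)\}$, $r_2=S^2\setminus\{(h,0),(1,0)\}$, $r_3=S^2\setminus\{(0,1),(h,1),(1,0),(1,h)\}$, let $\Pi^2_1,\Pi^2_2:S^2\to S$ be the two projections, let $\lambda_1$ be the binary partial operation with domain $r_1$ and graph $$\{(0,0,0),(h,h,h),(1,1,1),(0,h,h),(0,1,h),(h,0,0),(h,1,h),(1,h,1)\},$$ let $\lambda_2$ be the binary partial operation with domain $r_1^{-1}=S^2\setminus\{(0,1)\}$ and graph $$\{(0,0,0),(h,h,h),(1,1,1),(0,h,0),(h,0,h),(1,0,h),(h,1,1),(1,h,h)\},$$ and let $\mathcal T$ be the discrete topology on $S$. (1) The structure $\mathbf S_s=\langle S;\{r_1,r_2,r_3\},\{\Pi_1^2,\Pi_2^2\},\{\lambda_1,\lambda_2\},\mathcal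 T\rangle$ yields a strong duality on $\mathcal A$. That is, let $\chi_s=IS_cP^+(\mathbf S_s)$ be the category of isomorphic copies of topologically closed (possibly empty) substructures of powers of $\mathbf S_s$ with non-empty index set; its morphisms are the continuous maps preserving the relations, operations and partial operations. For $A\in\mathcal A$ let $D(A)=\mathcal A(A,\mathbb S)$ as a substructure of $\mathbf S_s^A$, and for $X\in\chi_s$ let $E(X)=\chi_s(X,\mathbf S_s)$ as a subalgebra of $\mathbb S^X$. Then for every $A\in\mathcal A$ the evaluation map $e_A:A\to ED(A)$ is an isomorphism; for every $X\in\chi_s$ the evaluation map $\varepsilon_X:X\to DE(X)$ is an isomorphism of $\chi_s$; and $\mathbf S_s$ is injective in $\chi_s$, i.e. for every embedding $f:X\to Y$ (an isomorphism onto a closed substructure) between objects of $\chi_s$ and every morphism $g:X\to\mathbf S_s$ there is a morphism $g':Y\to\mathbf S_s$ with $g'\circ f=g$. (2) Every algebraic binary partial operation on $S$, i.e. every homomorphism $\mu:B\to\mathbb S$ from a subalgebra $B$ of $\mathbb S^2$, is a restriction of $\Pi^2_1$, $\Pi^2_2$, $\lambda_1$ or $\lambda_2$. -/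

import Mathlib

universe u v

namespace NatDual

/-- The type of a structured topological space: names and finite arities of its relations, of its
total operations and of its partial operations. -/
structure Signature where
  Rel : Type
  relArity : Rel → ℕ
  Op : Type
  opArity : Op → ℕ
  POp : Type
  popArity : POp → ℕ

/-- A structured topological space `⟨X; G, H, R, 𝒯⟩` of type `L`. -/
structure StructuredSpace (L : Signature) : Type (u + 1) where
  carrier : Type u
  top : TopologicalSpace carrier
  rel : ∀ r : L.Rel, Set (Fin (L.relArity r) → carrier)
  op : ∀ g : L.Op, (Fin (L.opArity g) → carrier) → carrier
  pop : ∀ h : L.POp, (Fin (L.popArity h) → carrier) →. carrier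

instance (L : Signature) : CoeSort (StructuredSpace.{u} L) (Type u) := ⟨StructuredSpace.carrier⟩

attribute [instance] StructuredSpace.top

variable {L : Signature}

/-- Morphisms: continuous maps preserving all relations, operations and partial operations (if a
tuple is in the domain of a partial operation, then so is its image, and the values correspond). -/
structure IsMorphism (X : StructuredSpace.{u} L) (Y : StructuredSpace.{v} L) (f : X → Y) :
    Prop where
  continuous : Continuous f
  map_rel : ∀ (r : L.Rel) (x : Fin (L.relArity r) → X), x ∈ X.rel r → f ∘ x ∈ Y.rel r
  map_op : ∀ (g : L.Op) (x : Fin (L.opArity g) → X), f (X.op g x) = Y.op g (f ∘ x)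
  map_pop : ∀ (h : L.POp) (x : Fin (L.popArity h) → X) (a : X),
    a ∈ X.pop h x → f a ∈ Y.pop h (f ∘ x)

/-- Isomorphisms: morphisms with a two-sided inverse that is a morphism. -/
def IsIso (X : StructuredSpace.{u} L) (Y : StructuredSpace.{v} L) (f : X → Y) : Prop :=
  IsMorphism X Y f ∧
    ∃ g : Y → X, IsMorphism Y X g ∧ Function.LeftInverse g f ∧ Function.RightInverse g f

/-- Embeddings: isomorphisms onto a topologically closed substructure. A substructure is a subset
closed under the total operations, and under the partial operations wherever they are defined on it,
with the restricted relations and partial operations. That the image is closed under the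
operations, and under the partial operations, follows from the preservation clauses of
`IsMorphism` together with `dom_reflect`. -/
structure IsEmbedding (X : StructuredSpace.{u} L) (Y : StructuredSpace.{v} L) (f : X → Y) :
    Prop where
  isMorphism : IsMorphism X Y f
  isClosedEmbedding : Topology.IsClosedEmbedding f
  rel_reflect : ∀ (r : L.Rel) (x : Fin (L.relArity r) → X), f ∘ x ∈ Y.rel r → x ∈ X.rel r
  dom_reflect : ∀ (h : L.POp) (x : Fin (L.popArity h) → X),
    (Y.pop h (f ∘ x)).Dom → (X.pop h x).Dom

/-- A structure on the carrier of the algebra `M` (here a commutative semiring) all of whose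
relations, operations and partial operations are algebraic over `M`: relations are subalgebras of
finite powers, operations are homomorphisms from finite powers, and partial operations are
homomorphisms from subalgebras of finite powers. -/
structure AlterEgo (L : Signature) (M : Type) [CommSemiring M] where
  rel : ∀ r : L.Rel, Subsemiring (Fin (L.relArity r) → M)
  op : ∀ g : L.Op, (Fin (L.opArity g) → M) →+* M
  popDom : ∀ h : L.POp, Subsemiring (Fin (L.popArity h) → M)
  pop : ∀ h : L.POp, popDom h →+* M

variable {M : Type} [CommSemiring M]

namespace AlterEgo

variable (T : AlterEgo L M)

/-- The alter ego as a structured topological space, with the discrete topology. -/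
def toSpace : StructuredSpace.{0} L where
  carrier := M
  top := ⊥
  rel r := {x | x ∈ T.rel r}
  op g x := T.op g x
  pop h x := ⟨x ∈ T.popDom h, fun hx => T.pop h ⟨x, hx⟩⟩

instance : DiscreteTopology T.toSpace.carrier := ⟨rfl⟩

/-- The power with index set `I`: product topology and pointwise structure. -/
def power (I : Type u) : StructuredSpace.{u} L where
  carrier := I → M
  top := @Pi.topologicalSpace I (fun _ => M) (fun _ => ⊥)
  rel r := {x | ∀ i, (fun k => x k i) ∈ T.rel r}
  op g x := fun i => T.op g (fun k => x k i)
  pop h x := ⟨∀ i, (fun k => x k i) ∈ T.popDom h, fun hx i => T.pop h ⟨fun k => x k i, hx i⟩⟩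

/-- The class `IS_cP⁺` of isomorphic copies of closed substructures of powers with non-empty index
set. -/
def MemIScP (X : StructuredSpace.{u} L) : Prop :=
  ∃ I : Type u, Nonempty I ∧ ∃ f : X → T.power I, IsEmbedding X (T.power I) f

/-- The dual `D(A) = 𝒜(A, M)` of an algebra: all homomorphisms, with the topology and the pointwise
structure inherited from the power with index set `A`. -/
def dual (A : Type u) [CommSemiring A] : StructuredSpace.{u} L where
  carrier := A →+* M
  top := TopologicalSpace.induced (fun (φ : A →+* M) (a : A) => φ a)
    (@Pi.topologicalSpace A (fun _ => M) (fun _ => ⊥))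
  rel r := {φ | ∀ a, (fun k => φ k a) ∈ T.rel r}
  op g φ := (T.op g).comp (RingHom.pi φ)
  pop h φ := ⟨∀ a, (fun k => φ k a) ∈ T.popDom h,
    fun hφ => (T.pop h).comp ((RingHom.pi φ).codRestrict (T.popDom h) hφ)⟩

/-- The dual `E(X) = χ(X, M)` of a structured space: all morphisms into the alter ego, as a
subalgebra of the power `M ^ X`. -/
def homAlg (X : StructuredSpace.{u} L) : Subsemiring (X → M) where
  carrier := {f | IsMorphism X T.toSpace f}
  zero_mem' := by
    refine ⟨continuous_const, fun r x _ => (T.rel r).zero_mem, fun g x => ?_, fun h x a _ => ?_⟩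
    · exact (map_zero (T.op g)).symm
    · exact ⟨(T.popDom h).zero_mem, map_zero (T.pop h)⟩
  one_mem' := by
    refine ⟨continuous_const, fun r x _ => (T.rel r).one_mem, fun g x => ?_, fun h x a _ => ?_⟩
    · exact (map_one (T.op g)).symm
    · exact ⟨(T.popDom h).one_mem, map_one (T.pop h)⟩
  add_mem' := by
    rintro f f' hf hf'
    refine ⟨?_, fun r x hx => (T.rel r).add_mem (hf.map_rel r x hx) (hf'.map_rel r x hx),
      fun g x => ?_, fun h x a ha => ?_⟩
    · exact (continuous_of_discreteTopology (α := T.toSpace.carrier × T.toSpace.carrier)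
        (β := T.toSpace.carrier) (f := fun p => (fun a b : M => a + b) p.1 p.2)).comp
        (hf.continuous.prodMk hf'.continuous)
    · have h1 := hf.map_op g x
      have h2 := hf'.map_op g x
      have h3 := map_add (T.op g) (f ∘ x) (f' ∘ x)
      exact (congrArg₂ (fun a b : M => a + b) h1 h2).trans h3.symm
    · obtain ⟨d1, e1⟩ := hf.map_pop h x a ha
      obtain ⟨d2, e2⟩ := hf'.map_pop h x a ha
      have h3 := map_add (T.pop h) ⟨f ∘ x, d1⟩ ⟨f' ∘ x, d2⟩
      exact ⟨(T.popDom h).add_mem d1 d2, h3.trans (congrArg₂ (fun a b : M => a + b) e1 e2)⟩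
  mul_mem' := by
    rintro f f' hf hf'
    refine ⟨?_, fun r x hx => (T.rel r).mul_mem (hf.map_rel r x hx) (hf'.map_rel r x hx),
      fun g x => ?_, fun h x a ha => ?_⟩
    · exact (continuous_of_discreteTopology (α := T.toSpace.carrier × T.toSpace.carrier)
        (β := T.toSpace.carrier) (f := fun p => (fun a b : M => a * b) p.1 p.2)).comp
        (hf.continuous.prodMk hf'.continuous)
    · have h1 := hf.map_op g x
      have h2 := hf'.map_op g x
      have h3 := map_mul (T.op g) (f ∘ x) (f' ∘ x)
      exact (congrArg₂ (fun a b : M => a * b) h1 h2).trans h3.symm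
    · obtain ⟨d1, e1⟩ := hf.map_pop h x a ha
      obtain ⟨d2, e2⟩ := hf'.map_pop h x a ha
      have h3 := map_mul (T.pop h) ⟨f ∘ x, d1⟩ ⟨f' ∘ x, d2⟩
      exact ⟨(T.popDom h).mul_mem d1 d2, h3.trans (congrArg₂ (fun a b : M => a * b) e1 e2)⟩

theorem eval_isMorphism (A : Type u) [CommSemiring A] (a : A) :
    IsMorphism (T.dual A) T.toSpace (fun φ : A →+* M => φ a) := by
  refine ⟨?_, fun r φ hφ => hφ a, fun g φ => rfl, fun h φ ψ hψ => ?_⟩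
  · let : TopologicalSpace M := ⊥
    exact (continuous_apply a).comp continuous_induced_dom
  · obtain ⟨d, rfl⟩ := hψ
    exact ⟨d a, rfl⟩

/-- The evaluation homomorphism `e_A : A → ED(A)`, `a ↦ (φ ↦ φ a)`. -/
def evalAlg (A : Type u) [CommSemiring A] : A →+* T.homAlg (T.dual A) where
  toFun a := ⟨fun φ : A →+* M => φ a, T.eval_isMorphism A a⟩
  map_zero' := Subtype.ext (funext fun φ : A →+* M => map_zero φ)
  map_one' := Subtype.ext (funext fun φ : A →+* M => map_one φ)
  map_add' a b := Subtype.ext (funext fun φ : A →+* M => map_add φ a b)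
  map_mul' a b := Subtype.ext (funext fun φ : A →+* M => map_mul φ a b)

/-- The evaluation map `ε_X : X → DE(X)`, `x ↦ (f ↦ f x)`. -/
def evalSpace (X : StructuredSpace.{u} L) (x : X) : T.dual (T.homAlg X) :=
  ((Pi.evalRingHom (fun _ : X.carrier => M) x).comp (T.homAlg X).subtype : T.homAlg X →+* M)

end AlterEgo

/-- The quasi-variety `ISP(M)`: isomorphic copies of subalgebras of (possibly empty) powers. -/
def InQuasivariety (M : Type) [CommSemiring M] (A : Type u) [CommSemiring A] : Prop :=
  ∃ (I : Type u) (f : A →+* (I → M)), Function.Injective f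

/-- The hom-functors `D`, `E` go between the quasi-variety and the dual category. -/
theorem inQuasivariety_homAlg (T : AlterEgo L M) (X : StructuredSpace.{u} L) :
    InQuasivariety M (T.homAlg X) :=
  ⟨X, (T.homAlg X).subtype, Subtype.val_injective⟩

theorem memIScP_dual (T : AlterEgo L M) (A : Type u) [CommSemiring A] : T.MemIScP (T.dual A) := by
  let : TopologicalSpace M := ⊥
  have : DiscreteTopology M := ⟨rfl⟩
  refine ⟨A, ⟨0⟩, fun (φ : A →+* M) (a : A) => φ a, ⟨continuous_induced_dom, fun r φ hφ => hφ,
    fun g φ => rfl, fun h φ ψ hψ => ?_⟩, ⟨⟨⟨rfl⟩, DFunLike.coe_injective (F := A →+* M)⟩, ?_⟩,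
    fun r φ hφ => hφ, fun h φ hφ => hφ⟩
  · obtain ⟨d, rfl⟩ := hψ
    exact ⟨d, rfl⟩
  · have hc : ∀ a : A, Continuous fun f : A → M => f a := fun a => continuous_apply a
    have key : IsClosed {f : A → M | (f 0 = 0 ∧ f 1 = 1) ∧
        (∀ a b, f (a + b) = f a + f b) ∧ ∀ a b, f (a * b) = f a * f b} := by
      refine ((isClosed_eq (hc 0) continuous_const).inter
        (isClosed_eq (hc 1) continuous_const)).inter (IsClosed.inter ?_ ?_)
      · have e : {f : A → M | ∀ a b, f (a + b) = f a + f b} =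
            ⋂ a, ⋂ b, {f : A → M | f (a + b) = f a + f b} := by
          ext f
          simp
        have h2 : IsClosed (⋂ a, ⋂ b, {f : A → M | f (a + b) = f a + f b}) :=
          isClosed_iInter fun a => isClosed_iInter fun b => isClosed_eq (hc _)
            ((continuous_of_discreteTopology (f := fun p : M × M => p.1 + p.2)).comp
              ((hc a).prodMk (hc b)))
        rw [← e] at h2
        exact h2
      · have e : {f : A → M | ∀ a b, f (a * b) = f a * f b} =
            ⋂ a, ⋂ b, {f : A → M | f (a * b) = f a * f b} := by
          ext f
          simp
        have h2 : IsClosed (⋂ a, ⋂ b, {f : A → M | f (a * b) = f a * f b}) :=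
          isClosed_iInter fun a => isClosed_iInter fun b => isClosed_eq (hc _)
            ((continuous_of_discreteTopology (f := fun p : M × M => p.1 * p.2)).comp
              ((hc a).prodMk (hc b)))
        rw [← e] at h2
        exact h2
    have hr : Set.range (fun (φ : A →+* M) (a : A) => φ a) = {f : A → M |
        (f 0 = 0 ∧ f 1 = 1) ∧ (∀ a b, f (a + b) = f a + f b) ∧ ∀ a b, f (a * b) = f a * f b} := by
      ext f
      constructor
      · rintro ⟨φ, rfl⟩
        exact ⟨⟨map_zero φ, map_one φ⟩, map_add φ, map_mul φ⟩
      · rintro ⟨⟨h0, h1⟩, hadd, hmul⟩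
        exact ⟨(⟨⟨⟨f, h1⟩, hmul⟩, h0, hadd⟩ : A →+* M), rfl⟩
    exact hr ▸ key

/-- The alter ego `T` yields a strong duality on the quasi-variety `ISP(M)`: it yields a natural
duality (every `e_A` is an isomorphism), the duality is full (every `ε_X` is an isomorphism), and
the alter ego is injective in the dual category. -/
structure YieldsStrongDuality (T : AlterEgo L M) : Prop where
  duality : ∀ (A : Type u) [CommSemiring A], InQuasivariety M A → Function.Bijective (T.evalAlg A)
  full : ∀ X : StructuredSpace.{u} L, T.MemIScP X →
    IsIso X (T.dual (T.homAlg X)) (T.evalSpace X)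
  injective : ∀ X Y : StructuredSpace.{u} L, T.MemIScP X → T.MemIScP Y →
    ∀ f : X → Y, IsEmbedding X Y f → ∀ g : X → T.toSpace, IsMorphism X T.toSpace g →
      ∃ g' : Y → T.toSpace, IsMorphism Y T.toSpace g' ∧ g' ∘ f = g

/-- The carrier `{0, h, 1}`. -/
inductive S : Type
  | zero : S
  | h : S
  | one : S
  deriving DecidableEq

namespace S

instance : Fintype S := ⟨{zero, h, one}, by rintro ⟨⟩ <;> decide⟩

/-- Addition: `0` is neutral, `h + h = h`, `h + 1 = 1 + h = 1` and `1 + 1 = h`. -/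
def add : S → S → S
  | zero, b => b
  | a, zero => a
  | h, h => h
  | h, one => one
  | one, h => one
  | one, one => h

/-- Multiplication: the minimum for the order `0 < h < 1`. -/
def mul : S → S → S
  | zero, _ => zero
  | _, zero => zero
  | h, _ => h
  | _, h => h
  | one, one => one

instance : Zero S := ⟨zero⟩
instance : One S := ⟨one⟩
instance : Add S := ⟨add⟩
instance : Mul S := ⟨mul⟩

/-- The three-element Boolean semiring. -/
instance : CommSemiring S where
  nsmul := nsmulRec
  add_assoc := by rintro ⟨⟩ ⟨⟩ ⟨⟩ <;> rfl
  zero_add := by rintro ⟨⟩ <;> rfl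
  add_zero := by rintro ⟨⟩ <;> rfl
  add_comm := by rintro ⟨⟩ ⟨⟩ <;> rfl
  mul_assoc := by rintro ⟨⟩ ⟨⟩ ⟨⟩ <;> rfl
  one_mul := by rintro ⟨⟩ <;> rfl
  mul_one := by rintro ⟨⟩ <;> rfl
  zero_mul := by rintro ⟨⟩ <;> rfl
  mul_zero := by rintro ⟨⟩ <;> rfl
  mul_comm := by rintro ⟨⟩ ⟨⟩ <;> rfl
  left_distrib := by rintro ⟨⟩ ⟨⟩ ⟨⟩ <;> rfl
  right_distrib := by rintro ⟨⟩ ⟨⟩ ⟨⟩ <;> rfl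

/-- A binary relation on `S` that is closed under the operations, as a subalgebra of the square. -/
def relOf (P : S → S → Prop) (h0 : P 0 0) (h1 : P 1 1)
    (hadd : ∀ a b c d, P a b → P c d → P (a + c) (b + d))
    (hmul : ∀ a b c d, P a b → P c d → P (a * c) (b * d)) : Subsemiring (Fin 2 → S) where
  carrier := {x | P (x 0) (x 1)}
  zero_mem' := h0
  one_mem' := h1
  add_mem' {x y} hx hy := hadd (x 0) (x 1) (y 0) (y 1) hx hy
  mul_mem' {x y} hx hy := hmul (x 0) (x 1) (y 0) (y 1) hx hy

/-- `r₁ = S² - {(1,0)}`. -/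
def r₁ : Subsemiring (Fin 2 → S) :=
  relOf (fun a b => ¬(a = one ∧ b = zero)) (by decide) (by decide) (by decide) (by decide)

/-- `r₂ = S² - {(h,0), (1,0)}`. -/
def r₂ : Subsemiring (Fin 2 → S) :=
  relOf (fun a b => ¬(a = h ∧ b = zero) ∧ ¬(a = one ∧ b = zero))
    (by decide) (by decide) (by decide) (by decide)

/-- `r₃ = S² - {(0,1), (h,1), (1,0), (1,h)}`. -/
def r₃ : Subsemiring (Fin 2 → S) :=
  relOf (fun a b => ¬(a = zero ∧ b = one) ∧ ¬(a = h ∧ b = one) ∧ ¬(a = one ∧ b = zero) ∧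
    ¬(a = one ∧ b = h)) (by decide) (by decide) (by decide) (by decide)

/-- The inverse relation `r₁⁻¹ = S² - {(0,1)}`. -/
def r₁inv : Subsemiring (Fin 2 → S) :=
  relOf (fun a b => ¬(a = zero ∧ b = one)) (by decide) (by decide) (by decide) (by decide)

/-- The values of `λ₁`; the value at `(1,0)`, outside the domain `r₁`, is arbitrary. -/
def lam₁Val : S → S → S
  | zero, zero => zero
  | h, h => h
  | one, one => one
  | zero, h => h
  | zero, one => h
  | h, zero => zero
  | h, one => h
  | one, h => one
  | one, zero => zero

/-- The values of `λ₂`; the value at `(0,1)`, outside the domain `r₁⁻¹`, is arbitrary. -/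
def lam₂Val : S → S → S
  | zero, zero => zero
  | h, h => h
  | one, one => one
  | zero, h => zero
  | h, zero => h
  | one, zero => h
  | h, one => one
  | one, h => h
  | zero, one => zero

/-- The partial operation `λ₁` with domain `r₁`. -/
def lam₁ : r₁ →+* S where
  toFun x := lam₁Val (x.1 0) (x.1 1)
  map_zero' := rfl
  map_one' := rfl
  map_add' x y := (by decide : ∀ a b c d : S, ¬(a = one ∧ b = zero) → ¬(c = one ∧ d = zero) →
    lam₁Val (a + c) (b + d) = lam₁Val a b + lam₁Val c d) _ _ _ _ x.2 y.2
  map_mul' x y := (by decide : ∀ a b c d : S, ¬(a = one ∧ b = zero) → ¬(c = one ∧ d = zero) →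
    lam₁Val (a * c) (b * d) = lam₁Val a b * lam₁Val c d) _ _ _ _ x.2 y.2

/-- The partial operation `λ₂` with domain `r₁⁻¹`. -/
def lam₂ : r₁inv →+* S where
  toFun x := lam₂Val (x.1 0) (x.1 1)
  map_zero' := rfl
  map_one' := rfl
  map_add' x y := (by decide : ∀ a b c d : S, ¬(a = zero ∧ b = one) → ¬(c = zero ∧ d = one) →
    lam₂Val (a + c) (b + d) = lam₂Val a b + lam₂Val c d) _ _ _ _ x.2 y.2
  map_mul' x y := (by decide : ∀ a b c d : S, ¬(a = zero ∧ b = one) → ¬(c = zero ∧ d = one) →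
    lam₂Val (a * c) (b * d) = lam₂Val a b * lam₂Val c d) _ _ _ _ x.2 y.2

/-- Three relations, two total operations and two partial operations, all binary. -/
def sigS : Signature where
  Rel := Fin 3
  relArity _ := 2
  Op := Fin 2
  opArity _ := 2
  POp := Fin 2
  popArity _ := 2

/-- The structure `⟨S; {r₁, r₂, r₃}, {Π₁², Π₂²}, {λ₁, λ₂}, 𝒯⟩`. -/
def Sₛ : AlterEgo sigS S where
  rel := fun r : Fin 3 => match r with
    | 0 => r₁
    | 1 => r₂
    | 2 => r₃
  op := fun i : Fin 2 => Pi.evalRingHom (fun _ : Fin 2 => S) i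
  popDom := fun k : Fin 2 => match k with
    | 0 => r₁
    | 1 => r₁inv
  pop := fun k : Fin 2 => match k with
    | 0 => lam₁
    | 1 => lam₂

end S

end NatDual

namespace NatDual

/-! Two features of the semiring carry everything. The first is the majority term `ab + bc + ca`: by
Baker–Pixley and compactness, an algebra of locally constant functions is determined by its
projections to pairs of points, and the relations `r₁`, `r₂`, `r₃` control these (`exists_pair_eq`).
Hence a subalgebra of `E(X)` that already forces the relations of `X` is all of `E(X)`
(`le_of_reflects_rel`). Applied to the evaluations this is the duality; applied to restrictions of
morphisms from a larger space it is injectivity.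

The second is that `S` is a subdirect product of the field with two elements (collapse `0, h`) and
the two-element lattice (collapse `h, 1`), with `(1,0)` the only missing pair. By compactness each
component of a homomorphism into `S` comes from one point, and `λ₁` recombines the two components
(`exists_eq_lam₁Val`). Closure under `λ₁` turns the two points into one, which gives fullness; on a
two-point index set the same lemma classifies the binary partial operations. -/

theorem IsMorphism.comp {L : Signature} {X Y Z : StructuredSpace L} {g : Y → Z} {f : X → Y}
    (hg : IsMorphism Y Z g) (hf : IsMorphism X Y f) : IsMorphism X Z (g ∘ f) where
  continuous := hg.continuous.comp hf.continuous
  map_rel r x hx := hg.map_rel r _ (hf.map_rel r x hx)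
  map_op o x := (congrArg g (hf.map_op o x)).trans (hg.map_op o _)
  map_pop p x a ha := hg.map_pop p _ _ (hf.map_pop p x a ha)

/-! ### Generalities on alter egos -/

namespace AlterEgo

variable {L : Signature} {M : Type} [CommSemiring M] (T : AlterEgo L M)

theorem isLocallyConstant_of_mem_homAlg {X : StructuredSpace L} {a : X → M}
    (ha : a ∈ T.homAlg X) : IsLocallyConstant a := fun s => by
  have hc : Continuous (Y := T.toSpace) a := IsMorphism.continuous ha
  exact (isOpen_discrete (α := T.toSpace) s).preimage hc

theorem coord_isMorphism (I : Type*) (i : I) :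
    IsMorphism (T.power I) T.toSpace (fun x : I → M => x i) := by
  refine ⟨?_, fun r x hx => hx i, fun g x => rfl, fun h x a ha => ?_⟩
  · let : TopologicalSpace M := ⊥
    exact continuous_apply i
  · obtain ⟨d, rfl⟩ := ha
    exact ⟨d i, rfl⟩

theorem compactSpace_of_memIScP [Finite M] {X : StructuredSpace L} (hX : T.MemIScP X) :
    CompactSpace X := by
  obtain ⟨I, -, f, hf⟩ := hX
  let : TopologicalSpace M := ⊥
  have : CompactSpace (T.power I) := inferInstanceAs (CompactSpace (I → M))
  exact hf.isClosedEmbedding.compactSpace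

/-- The coordinates of an embedding into a power are themselves morphisms into the alter ego, so
these suffice to test a relation. -/
theorem mem_rel_of_forall_homAlg {X : StructuredSpace L} (hX : T.MemIScP X) (r : L.Rel)
    (x : Fin (L.relArity r) → X) (h : ∀ a ∈ T.homAlg X, a ∘ x ∈ T.rel r) : x ∈ X.rel r := by
  obtain ⟨I, -, f, hf⟩ := hX
  exact hf.rel_reflect r x fun i => h _ ((T.coord_isMorphism I i).comp hf.isMorphism)

theorem pop_dom_of_forall_homAlg {X : StructuredSpace L} (hX : T.MemIScP X) (p : L.POp)
    (x : Fin (L.popArity p) → X) (h : ∀ a ∈ T.homAlg X, a ∘ x ∈ T.popDom p) :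
    (X.pop p x).Dom := by
  obtain ⟨I, -, f, hf⟩ := hX
  exact hf.dom_reflect p x fun i => h _ ((T.coord_isMorphism I i).comp hf.isMorphism)

theorem evalSpace_injective {X : StructuredSpace L} (hX : T.MemIScP X) :
    Function.Injective (T.evalSpace X) := by
  obtain ⟨I, -, f, hf⟩ := hX
  intro x y hxy
  refine hf.isClosedEmbedding.injective (funext fun i => ?_)
  exact RingHom.congr_fun (hxy : (T.evalSpace X x : T.homAlg X →+* M) = T.evalSpace X y)
    ⟨_, (T.coord_isMorphism I i).comp hf.isMorphism⟩

theorem evalSpace_isMorphism (X : StructuredSpace L) :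
    IsMorphism X (T.dual (T.homAlg X)) (T.evalSpace X) where
  continuous := by
    let : TopologicalSpace M := ⊥
    refine continuous_induced_rng.2 (continuous_pi fun a => ?_)
    exact IsMorphism.continuous a.2
  map_rel r x hx a := IsMorphism.map_rel a.2 r x hx
  map_op g x := RingHom.ext fun a => IsMorphism.map_op a.2 g x
  map_pop p x y hy := by
    have h := fun a : T.homAlg X => IsMorphism.map_pop a.2 p x y hy
    exact ⟨fun a => (h a).1, RingHom.ext fun a => (h a).2⟩

instance (A : Type*) [CommSemiring A] : T2Space (T.dual A) := by
  let : TopologicalSpace M := ⊥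
  have : DiscreteTopology M := ⟨rfl⟩
  exact T2Space.of_injective_continuous (Y := A → M) (f := fun (φ : A →+* M) (a : A) => φ a)
    (DFunLike.coe_injective (F := A →+* M)) continuous_induced_dom

/-- Only surjectivity needs work: morphisms separate points and detect relations and domains, and a
continuous bijection from a compact to a Hausdorff space has a continuous inverse. -/
theorem isIso_evalSpace [Finite M] {X : StructuredSpace L} (hX : T.MemIScP X)
    (hs : Function.Surjective (T.evalSpace X)) : IsIso X (T.dual (T.homAlg X)) (T.evalSpace X) := by
  have := T.compactSpace_of_memIScP hX
  have hm := T.evalSpace_isMorphism X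
  have hi := T.evalSpace_injective hX
  let e := Equiv.ofBijective _ ⟨hi, hs⟩
  have hl : Function.LeftInverse e.symm (T.evalSpace X) := e.symm_apply_apply
  have hr : Function.RightInverse e.symm (T.evalSpace X) := e.apply_symm_apply
  have hx : ∀ {n : ℕ} (φ : Fin n → T.dual (T.homAlg X)), ∃ x : Fin n → X,
      φ = T.evalSpace X ∘ x ∧ e.symm ∘ φ = x := fun φ =>
    ⟨e.symm ∘ φ, funext fun k => (hr (φ k)).symm, rfl⟩
  refine ⟨hm, e.symm, ⟨?_, fun r φ hφ => ?_, fun g φ => ?_, fun p φ ψ hψ => ?_⟩, hl, hr⟩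
  · exact (hm.continuous.isClosedEmbedding hi).isEmbedding.continuous_iff.2
      (continuous_id.congr fun φ => (hr φ).symm)
  · obtain ⟨x, rfl, hx⟩ := hx φ
    rw [hx]
    exact T.mem_rel_of_forall_homAlg hX r x fun a ha => hφ ⟨a, ha⟩
  · obtain ⟨x, rfl, hx⟩ := hx φ
    rw [hx, ← hm.map_op, hl]
  · obtain ⟨x, rfl, hx⟩ := hx φ
    rw [hx]
    have hd : (X.pop p x).Dom := T.pop_dom_of_forall_homAlg hX p x fun a ha => hψ.1 ⟨a, ha⟩
    have he := hm.map_pop p x _ (Part.get_mem hd)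
    rw [Part.mem_unique hψ he, hl]
    exact Part.get_mem hd

end AlterEgo

/-! ### Majority interpolation -/

namespace S

variable {X : Type*}

/-- The majority term of the three-element Boolean semiring. -/
def maj {R : Type*} [CommSemiring R] (a b c : R) : R := a * b + b * c + c * a

theorem maj_mem (A : Subsemiring (X → S)) {a b c : X → S} (ha : a ∈ A) (hb : b ∈ A) (hc : c ∈ A) :
    maj a b c ∈ A :=
  A.add_mem (A.add_mem (A.mul_mem ha hb) (A.mul_mem hb hc)) (A.mul_mem hc ha)

theorem maj_eq_of_two {a b c s : S} (h : a = s ∧ b = s ∨ b = s ∧ c = s ∨ a = s ∧ c = s) :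
    maj a b c = s := by
  revert a b c s
  unfold maj
  decide

/-- The Baker–Pixley interpolation argument over a finite set of blocks. -/
theorem exists_interpolant_of_pairs {ι : Type*} (A : Subsemiring (X → S)) (g : X → S) (c : X → ι)
    (T : Finset ι)
    (h : ∀ i ∈ T, ∀ j ∈ T, ∃ a ∈ A, ∀ x, c x = i ∨ c x = j → a x = g x) :
    ∃ a ∈ A, ∀ x, c x ∈ T → a x = g x := by
  classical
  induction hn : T.card using Nat.strong_induction_on generalizing T with
  | _ n ih =>
    subst hn
    have erase : ∀ i ∈ T, ∃ a ∈ A, ∀ x, c x ∈ T → c x ≠ i → a x = g x := fun i hi => by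
      obtain ⟨a, ha, hax⟩ := ih _ (Finset.card_erase_lt_of_mem hi) (T.erase i)
        (fun j hj k hk => h j (Finset.mem_of_mem_erase hj) k (Finset.mem_of_mem_erase hk)) rfl
      exact ⟨a, ha, fun x hx hne => hax x (Finset.mem_erase.2 ⟨hne, hx⟩)⟩
    -- Given three blocks, each point is missed by at most one of the three interpolants obtained by
    -- erasing a block, so their majority is correct everywhere.
    by_cases h3 : 2 < T.card
    · obtain ⟨i, hi, j, hj, k, hk, hij, hik, hjk⟩ := Finset.two_lt_card.1 h3
      obtain ⟨a, ha, hax⟩ := erase i hi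
      obtain ⟨b, hb, hbx⟩ := erase j hj
      obtain ⟨d, hd, hdx⟩ := erase k hk
      refine ⟨_, maj_mem A ha hb hd, fun x hx => maj_eq_of_two (a := a x) (b := b x) (c := d x) ?_⟩
      by_cases e1 : c x = i
      · exact .inr (.inl ⟨hbx x hx (e1 ▸ hij), hdx x hx (e1 ▸ hik)⟩)
      · by_cases e2 : c x = j
        · exact .inr (.inr ⟨hax x hx e1, hdx x hx (e2 ▸ hjk)⟩)
        · exact .inl ⟨hax x hx e1, hbx x hx e2⟩
    · rcases T.eq_empty_or_nonempty with rfl | ⟨i, hi⟩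
      · exact ⟨0, A.zero_mem, by simp⟩
      · have : ∃ j ∈ T, ∀ k ∈ T, k = i ∨ k = j := by
          by_contra! hc
          obtain ⟨j, hj, hji, -⟩ := hc i hi
          obtain ⟨k, hk, hki, hkj⟩ := hc j hj
          exact h3 (Finset.two_lt_card.2 ⟨i, hi, j, hj, k, hk, hji.symm, hki.symm, hkj.symm⟩)
        obtain ⟨j, hj, hall⟩ := this
        obtain ⟨a, ha, hax⟩ := h i hi j hj
        exact ⟨a, ha, fun x hx => hax x (hall _ hx)⟩

/-- On a compact space, a locally constant function that is interpolated by `A` at any two points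
belongs to `A`. -/
theorem mem_of_forall_pair [TopologicalSpace X] [CompactSpace X] (A : Subsemiring (X → S))
    (hA : ∀ a ∈ A, IsLocallyConstant a) {g : X → S} (hg : IsLocallyConstant g)
    (h : ∀ x y, ∃ a ∈ A, a x = g x ∧ a y = g y) : g ∈ A := by
  classical
  have hopen : ∀ a ∈ A, IsOpen {x | a x = g x} := fun a ha => by
    have := (hA a ha).prodMk hg {p | p.1 = p.2}
    exact this
  obtain ⟨F, hF, hpair⟩ : ∃ F : Finset (X → S), (∀ a ∈ F, a ∈ A) ∧
      ∀ p ∈ (Set.univ : Set (X × X)), ∃ a ∈ F, a p.1 = g p.1 ∧ a p.2 = g p.2 := by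
    refine isCompact_univ.induction_on (p := fun Z : Set (X × X) => ∃ F : Finset (X → S),
      (∀ a ∈ F, a ∈ A) ∧ ∀ p ∈ Z, ∃ a ∈ F, a p.1 = g p.1 ∧ a p.2 = g p.2) ⟨∅, by simp⟩ ?_ ?_ ?_
    · rintro s t hst ⟨F, hF, hp⟩
      exact ⟨F, hF, fun p hps => hp p (hst hps)⟩
    · rintro s t ⟨F, hF, hp⟩ ⟨G, hG, hq⟩
      refine ⟨F ∪ G, fun a ha => (Finset.mem_union.1 ha).elim (hF a) (hG a), ?_⟩
      rintro p (hps | hpt)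
      · obtain ⟨a, ha, e⟩ := hp p hps
        exact ⟨a, Finset.mem_union_left _ ha, e⟩
      · obtain ⟨a, ha, e⟩ := hq p hpt
        exact ⟨a, Finset.mem_union_right _ ha, e⟩
    · rintro ⟨x, y⟩ -
      obtain ⟨a, ha, e⟩ := h x y
      refine ⟨_, mem_nhdsWithin_of_mem_nhds
        (((hopen a ha).prod (hopen a ha)).mem_nhds (Set.mk_mem_prod e.1 e.2)), {a}, ?_, ?_⟩
      · simpa using ha
      · rintro p ⟨h1, h2⟩
        exact ⟨a, Finset.mem_singleton_self a, h1, h2⟩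
  -- A block records which members of `F` agree with `g`; agreement at one point thus spreads to its
  -- whole block.
  let c : X → Finset (X → S) := fun x => F.filter fun a => a x = g x
  obtain ⟨a, ha, hax⟩ := exists_interpolant_of_pairs A g c
    (F.powerset.filter fun i => ∃ x, c x = i) (by
      intro i hi j hj
      obtain ⟨x, rfl⟩ := (Finset.mem_filter.1 hi).2
      obtain ⟨y, rfl⟩ := (Finset.mem_filter.1 hj).2
      obtain ⟨a, ha, e1, e2⟩ := hpair (x, y) trivial
      refine ⟨a, hF a ha, ?_⟩
      rintro z (hz | hz)
      · exact (Finset.mem_filter.1 (hz ▸ Finset.mem_filter.2 ⟨ha, e1⟩ : a ∈ c z)).2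
      · exact (Finset.mem_filter.1 (hz ▸ Finset.mem_filter.2 ⟨ha, e2⟩ : a ∈ c z)).2)
  have : a = g := funext fun x => hax x
    (Finset.mem_filter.2 ⟨Finset.mem_powerset.2 (Finset.filter_subset _ _), x, rfl⟩)
  exact this ▸ ha

/-- The subalgebras of the square are determined by `r₁`, `r₂`, `r₃` and their inverses. -/
theorem exists_pair_eq (A : Subsemiring (X → S)) {g : X → S} {x y : X}
    (h : ∀ r : Fin 3, ∀ x y, (∀ a ∈ A, ![a x, a y] ∈ Sₛ.rel r) → ![g x, g y] ∈ Sₛ.rel r) :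
    ∃ a ∈ A, a x = g x ∧ a y = g y := by
  have h₁ : ∀ x y, (∀ a ∈ A, ¬(a x = one ∧ a y = zero)) → ¬(g x = one ∧ g y = zero) := h 0
  have h₂ : ∀ x y, (∀ a ∈ A, ¬(a x = S.h ∧ a y = zero) ∧ ¬(a x = one ∧ a y = zero)) →
      ¬(g x = S.h ∧ g y = zero) ∧ ¬(g x = one ∧ g y = zero) := h 1
  have h₃ : ∀ x y, (∀ a ∈ A, ¬(a x = zero ∧ a y = one) ∧ ¬(a x = S.h ∧ a y = one) ∧
      ¬(a x = one ∧ a y = zero) ∧ ¬(a x = one ∧ a y = S.h)) →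
      ¬(g x = zero ∧ g y = one) ∧ ¬(g x = S.h ∧ g y = one) ∧
      ¬(g x = one ∧ g y = zero) ∧ ¬(g x = one ∧ g y = S.h) := h 2
  have one_zero : ∀ x y, g x = one → g y = zero → ∃ a ∈ A, a x = one ∧ a y = zero := by
    intro x y hx hy
    by_contra! hc
    exact h₁ x y (fun a ha e => hc a ha e.1 e.2) ⟨hx, hy⟩
  have hh : (1 + 1 : X → S) ∈ A := A.add_mem A.one_mem A.one_mem
  have h_zero : ∀ x y, g x = S.h → g y = zero → ∃ a ∈ A, a x = S.h ∧ a y = zero := by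
    intro x y hx hy
    by_contra! hc
    refine (h₂ x y fun a ha => ⟨fun e => hc a ha e.1 e.2, fun e => ?_⟩).1 ⟨hx, hy⟩
    -- Doubling turns `(1,0)` into `(h,0)`.
    exact hc (a + a) (A.add_mem ha ha) (by simp [e.1]; rfl) (by simp [e.2]; rfl)
  have h_one : ∀ x y, g x = S.h → g y = one → ∃ a ∈ A, a x = S.h ∧ a y = one := by
    intro x y hx hy
    by_contra! hc
    -- Every pair outside `r₃` generates `(h,1)`: add the constant `h = 1 + 1` to `(0,1)`, or `1` to
    -- `(1,0)` and `(1,h)`.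
    refine (h₃ x y fun a ha => ⟨fun e => ?_, fun e => ?_, fun e => ?_, fun e => ?_⟩).2.1 ⟨hx, hy⟩
    · exact hc (a + (1 + 1)) (A.add_mem ha hh) (by simp [e.1]; rfl) (by simp [e.2]; rfl)
    · exact hc a ha e.1 e.2
    · exact hc (a + 1) (A.add_mem ha A.one_mem) (by simp [e.1]; rfl) (by simp [e.2]; rfl)
    · exact hc (a + 1) (A.add_mem ha A.one_mem) (by simp [e.1]; rfl) (by simp [e.2]; rfl)
  have swap : ∀ {s t}, (∃ a ∈ A, a y = s ∧ a x = t) → ∃ a ∈ A, a x = t ∧ a y = s :=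
    fun ⟨a, ha, e1, e2⟩ => ⟨a, ha, e2, e1⟩
  rcases hx : g x with _ | _ | _ <;> rcases hy : g y with _ | _ | _
  · exact ⟨0, A.zero_mem, rfl, rfl⟩
  · exact swap (h_zero y x hy hx)
  · exact swap (one_zero y x hy hx)
  · exact h_zero x y hx hy
  · exact ⟨_, hh, rfl, rfl⟩
  · exact h_one x y hx hy
  · exact one_zero x y hx hy
  · exact swap (h_one y x hy hx)
  · exact ⟨1, A.one_mem, rfl, rfl⟩

/-- A pair of values missing from `A` at two points would put those points in some relation of `X`,
which every morphism must preserve. -/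
theorem le_of_reflects_rel {X : StructuredSpace sigS} [CompactSpace X]
    (A : Subsemiring (X → S)) (hA : A ≤ Sₛ.homAlg X)
    (h : ∀ r (x : Fin 2 → X), (∀ a ∈ A, a ∘ x ∈ Sₛ.rel r) → x ∈ X.rel r) :
    Sₛ.homAlg X ≤ A := by
  intro g hg
  have vec : ∀ (f : X → S) (x y : X), f ∘ ![x, y] = ![f x, f y] := fun f x y => by
    ext k; fin_cases k <;> rfl
  refine mem_of_forall_pair A (fun a ha => Sₛ.isLocallyConstant_of_mem_homAlg (hA ha))
    (Sₛ.isLocallyConstant_of_mem_homAlg hg) fun x y => exists_pair_eq A fun r x y hr => ?_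
  rw [← vec]
  exact IsMorphism.map_rel hg r _ (h r _ fun a ha => (vec a x y).symm ▸ hr a ha)

/-! ### Homomorphisms into the semiring -/

/-- A homomorphism into `S` is determined by one point modulo the congruence collapsing `0, h`. -/
theorem exists_eq_one_iff [TopologicalSpace X] [CompactSpace X] (A : Subsemiring (X → S))
    (hA : ∀ a ∈ A, IsLocallyConstant a) (u : A →+* S) :
    ∃ x, ∀ a : A, u a = one ↔ a.1 x = one := by
  by_contra! hc
  obtain ⟨a, ha, hax⟩ : ∃ a : A, u a ≠ one ∧ ∀ x ∈ (Set.univ : Set X), a.1 x = one := by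
    refine isCompact_univ.induction_on
      (p := fun Z : Set X => ∃ a : A, u a ≠ one ∧ ∀ x ∈ Z, a.1 x = one) ?_ ?_ ?_ ?_
    · exact ⟨0, by rw [map_zero]; decide, by simp⟩
    · rintro s t hst ⟨a, ha, h⟩
      exact ⟨a, ha, fun x hx => h x (hst hx)⟩
    · rintro s t ⟨a, ha, has⟩ ⟨b, hb, hbt⟩
      -- Boolean disjunction modulo the congruence: the value is `1` exactly when one of the two is.
      refine ⟨a + b + a * b, ?_, ?_⟩
      · rw [map_add, map_add, map_mul]
        exact (by decide : ∀ p q : S, p ≠ one → q ≠ one → p + q + p * q ≠ one) _ _ ha hb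
      · intro x hx
        exact (by decide : ∀ p q : S, p = one ∨ q = one → p + q + p * q = one) (a.1 x) (b.1 x)
          (hx.imp (has x) (hbt x))
    · intro x _
      obtain ⟨a, ha, hax⟩ : ∃ a : A, u a ≠ one ∧ a.1 x = one := by
        obtain ⟨a, ⟨h1, h2⟩ | ⟨h1, h2⟩⟩ := hc x
        -- Adding `1` is complementation in the two-element field.
        · refine ⟨a + 1, ?_, ?_⟩
          · rw [map_add, map_one, h1]; decide
          · exact (by decide : ∀ p : S, p ≠ one → p + 1 = one) _ h2
        · exact ⟨a, h1, h2⟩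
      exact ⟨_, mem_nhdsWithin_of_mem_nhds ((hA a.1 a.2 {one}).mem_nhds hax), a, ha,
        fun y hy => hy⟩
  have : a = 1 := Subtype.ext (funext fun x => hax x trivial)
  exact ha (this ▸ map_one u)

/-- A homomorphism into `S` is determined by one point modulo the congruence collapsing `h, 1`. -/
theorem exists_eq_zero_iff [TopologicalSpace X] [CompactSpace X] (A : Subsemiring (X → S))
    (hA : ∀ a ∈ A, IsLocallyConstant a) (u : A →+* S) :
    ∃ x, ∀ a : A, u a = zero ↔ a.1 x = zero := by
  by_contra! hc
  -- The lattice quotient has no complement, so the compactness argument carries a pair: `c`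
  -- vanishes wherever `b` does, on larger and larger sets.
  obtain ⟨b, c, hb, hc, hbc⟩ : ∃ b c : A, u b = zero ∧ u c ≠ zero ∧
      ∀ x ∈ (Set.univ : Set X), b.1 x ≠ zero ∨ c.1 x = zero := by
    refine isCompact_univ.induction_on (p := fun Z : Set X => ∃ b c : A, u b = zero ∧ u c ≠ zero ∧
      ∀ x ∈ Z, b.1 x ≠ zero ∨ c.1 x = zero) ?_ ?_ ?_ ?_
    · exact ⟨0, 1, map_zero u, by rw [map_one]; decide, by simp⟩
    · rintro s t hst ⟨b, c, hb, hc, h⟩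
      exact ⟨b, c, hb, hc, fun x hx => h x (hst hx)⟩
    · rintro s t ⟨b, c, hb, hc, h⟩ ⟨b', c', hb', hc', h'⟩
      refine ⟨b + b', c * c', ?_, ?_, ?_⟩
      · rw [map_add, hb, hb']; rfl
      · rw [map_mul]
        exact (by decide : ∀ p q : S, p ≠ zero → q ≠ zero → p * q ≠ zero) _ _ hc hc'
      · intro x hx
        exact (by decide : ∀ p q p' q' : S, (p ≠ zero ∨ q = zero) ∨ (p' ≠ zero ∨ q' = zero) →
          p + p' ≠ zero ∨ q * q' = zero) (b.1 x) (c.1 x) (b'.1 x) (c'.1 x)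
          (hx.imp (h x) (h' x))
    · intro x _
      obtain ⟨a, ⟨h1, h2⟩ | ⟨h1, h2⟩⟩ := hc x
      · exact ⟨_, mem_nhdsWithin_of_mem_nhds ((hA a.1 a.2 {zero}ᶜ).mem_nhds h2), a, 1, h1,
          by rw [map_one]; decide, fun y hy => .inl hy⟩
      · exact ⟨_, mem_nhdsWithin_of_mem_nhds ((hA a.1 a.2 {zero}).mem_nhds h2), 0, a, map_zero u,
          h1, fun y hy => .inr hy⟩
  -- Multiplying by `h = 1 + 1` sends every nonzero value to `h`, so the inclusion of supports
  -- becomes an identity that `u` preserves.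
  have e : (1 + 1) * b + (1 + 1) * c = (1 + 1) * b := Subtype.ext (funext fun x =>
    (by decide : ∀ p q : S, p ≠ zero ∨ q = zero → (1 + 1) * p + (1 + 1) * q = (1 + 1) * p)
      (b.1 x) (c.1 x) (hbc x trivial))
  have e' := congrArg u e
  simp only [map_add, map_mul, map_one, hb] at e'
  exact (by decide : ∀ q : S, q ≠ zero → (1 + 1) * zero + (1 + 1) * q ≠ (1 + 1) * zero) _ hc e'

/-- Every homomorphism from a subalgebra of a power into `S` is given by `λ₁` at two points. -/
theorem exists_eq_lam₁Val [TopologicalSpace X] [CompactSpace X] (A : Subsemiring (X → S))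
    (hA : ∀ a ∈ A, IsLocallyConstant a) (u : A →+* S) :
    ∃ x y, ∀ a : A, ¬(a.1 x = one ∧ a.1 y = zero) ∧ u a = lam₁Val (a.1 x) (a.1 y) := by
  obtain ⟨x, hx⟩ := exists_eq_one_iff A hA u
  obtain ⟨y, hy⟩ := exists_eq_zero_iff A hA u
  exact ⟨x, y, fun a => (by decide : ∀ s p q : S, (s = one ↔ p = one) → (s = zero ↔ q = zero) →
    ¬(p = one ∧ q = zero) ∧ s = lam₁Val p q) _ _ _ (hx a) (hy a)⟩

/-! ### Fullness, duality and injectivity -/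

/-- The two points representing a homomorphism lie in the domain of `λ₁` on `X`, and its value there
is the required point. -/
theorem evalSpace_surjective {X : StructuredSpace sigS} (hX : Sₛ.MemIScP X) :
    Function.Surjective (Sₛ.evalSpace X) := by
  intro u
  have := Sₛ.compactSpace_of_memIScP hX
  obtain ⟨x, y, hxy⟩ := exists_eq_lam₁Val (Sₛ.homAlg X)
    (fun a ha => Sₛ.isLocallyConstant_of_mem_homAlg ha) u
  have hd : (X.pop (0 : Fin 2) ![x, y]).Dom :=
    Sₛ.pop_dom_of_forall_homAlg hX (0 : Fin 2) ![x, y] fun a ha => (hxy ⟨a, ha⟩).1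
  refine ⟨(X.pop (0 : Fin 2) ![x, y]).get hd, RingHom.ext fun a => ?_⟩
  obtain ⟨d, e⟩ := IsMorphism.map_pop a.2 (0 : Fin 2) ![x, y] _ (Part.get_mem hd)
  exact e.symm.trans (hxy a).2.symm

theorem duality (A : Type*) [CommSemiring A] (hA : InQuasivariety S A) :
    Function.Bijective (Sₛ.evalAlg A) := by
  constructor
  · obtain ⟨I, f, hf⟩ := hA
    intro a b hab
    refine hf (funext fun i => ?_)
    exact congrFun (congrArg Subtype.val hab) ((Pi.evalRingHom _ i).comp f : A →+* S)
  · rintro ⟨g, hg⟩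
    have := Sₛ.compactSpace_of_memIScP (memIScP_dual Sₛ A)
    let ev : A →+* (Sₛ.dual A → S) := (Sₛ.homAlg (Sₛ.dual A)).subtype.comp (Sₛ.evalAlg A)
    obtain ⟨a, ha⟩ := le_of_reflects_rel ev.rangeS
      (by rintro _ ⟨a, rfl⟩; exact (Sₛ.evalAlg A a).2)
      (fun r x hx a => hx _ ⟨a, rfl⟩) hg
    exact ⟨a, Subtype.ext ha⟩

/-- Restrictions along `f` of morphisms on `Y` already detect the relations of `X`, so they exhaust
`E(X)`. -/
theorem exists_extension {X Y : StructuredSpace sigS} (hX : Sₛ.MemIScP X) (hY : Sₛ.MemIScP Y)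
    {f : X → Y} (hf : IsEmbedding X Y f) {g : X → S} (hg : IsMorphism X Sₛ.toSpace g) :
    ∃ g' : Y → S, IsMorphism Y Sₛ.toSpace g' ∧ g' ∘ f = g := by
  have := Sₛ.compactSpace_of_memIScP hX
  let res : (Y → S) →+* (X → S) := RingHom.pi fun x => Pi.evalRingHom _ (f x)
  obtain ⟨g', hg', e⟩ := le_of_reflects_rel ((Sₛ.homAlg Y).map res)
    (by
      rintro _ ⟨a, ha, rfl⟩
      have ha : IsMorphism Y Sₛ.toSpace a := ha
      exact ha.comp hf.isMorphism)
    (fun r x hx => hf.rel_reflect r x (Sₛ.mem_rel_of_forall_homAlg hY r _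
      fun a ha => hx _ ⟨a, ha, rfl⟩)) hg
  exact ⟨g', hg', e⟩

end S

end NatDual

theorem proposition4p5 :
    NatDual.YieldsStrongDuality.{u} NatDual.S.Sₛ ∧
    ∀ (B : Subsemiring (Fin 2 → NatDual.S)) (μ : B →+* NatDual.S),
      (∀ x : B, μ x = x.1 0) ∨ (∀ x : B, μ x = x.1 1) ∨
      (∃ hB : B ≤ NatDual.S.r₁, ∀ x : B, μ x = NatDual.S.lam₁ ⟨x.1, hB x.2⟩) ∨
      (∃ hB : B ≤ NatDual.S.r₁inv, ∀ x : B, μ x = NatDual.S.lam₂ ⟨x.1, hB x.2⟩) := by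
  refine ⟨⟨fun A _ hA => NatDual.S.duality A hA, fun X hX => NatDual.S.Sₛ.isIso_evalSpace hX
    (NatDual.S.evalSpace_surjective hX), fun X Y hX hY f hf g hg =>
    NatDual.S.exists_extension hX hY hf hg⟩, fun B μ => ?_⟩
  obtain ⟨x, y, h⟩ := NatDual.S.exists_eq_lam₁Val B (fun _ _ => .of_discrete _) μ
  have diag : ∀ s : NatDual.S, NatDual.S.lam₁Val s s = s := by decide
  -- Equal points give a projection, the points in order give `λ₁`, and in reverse order `λ₂`, which
  -- is `λ₁` with its arguments exchanged.
  fin_cases x <;> fin_cases y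
  · exact .inl fun a => (h a).2.trans (diag _)
  · exact .inr (.inr (.inl ⟨fun a ha => (h ⟨a, ha⟩).1, fun a => (h a).2⟩))
  · refine .inr (.inr (.inr ⟨fun a ha e => (h ⟨a, ha⟩).1 e.symm, fun a => ?_⟩))
    exact (h a).2.trans ((by decide : ∀ p q : NatDual.S,
      NatDual.S.lam₁Val p q = NatDual.S.lam₂Val q p) _ _)
  · exact .inr (.inl fun a => (h a).2.trans (diag _))
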